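/- There is an absolute constant $c\le 4$ such that the following holds. Let $n\ge 0$ and let $\mathcal G$ be a set of elementary gates on $n$ qubits, each gate being a unitary applied to specified qubits of the register and the identity on the others. Suppose that $\mathcal G$ is closed under inversion and universal, that is, for every unitary $U$ on $(\mathbb C^2)^{\otimes n}$ and every $\delta>0$ there are a finite product $g_1\cdots g_l$ of gates of $\mathcal G$ and a phase $\theta\in\mathbb R$ with $\|g_1\cdots g_l-e^{i\theta}U\|<\delta$ in operator norm. Then there is a constant $C$, depending only on $n$ and $\mathcal G$, such that for every Hamiltonian (Hermitian operator) $H$ on $(\mathbb C^2)^{\otimes n}$ there is a constant $K$ with the following property. Let $E_0$ be the lowest eigenvalue of $H$ and let $|\psi_0\rangle$ be any normalized ground state, $H|\psi_0\rangle=E_0|\psi_0\rangle$. For every $\varepsilon>0$ there is a circuit $\tilde U=g_1\cdots g_l$ of gates from $\mathcal G$ whose output $|\tilde\psi_0\rangle=\tilde U|0\rangle^{\otimes n}$ satisfies \[ \|\,|\tilde\psi_0\rangle-e^{i\theta}|\psi_0\rangle\|\le\varepsilon\ \text{ for some }\theta\in\mathbb R, \qquad \bigl|\langle\tilde\psi_0|H|\tilde\psi_0\rangle-E_0\bigr|\le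 K\varepsilon^2, \] and whose number of gates satisfies $l\le C\,\log^{c}(1/\varepsilon)$ whenever $\varepsilon\le 1/2$. -/

import Mathlib

open scoped Matrix.Norms.L2Operator Matrix

noncomputable section

namespace VQE

/-- Labels of the computational basis of `n` qubits. -/
abbrev Bits (n : ℕ) : Type := Fin n → Fin 2

/-- The Hilbert space `(ℂ²)^{⊗ n}` of `n` qubits, in the computational basis. -/
abbrev Qubits (n : ℕ) : Type := EuclideanSpace ℂ (Bits n)

/-- The operator on `n` qubits that acts as the matrix `A` on the qubits listed by `t` and as the
identity on all other qubits. -/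
def extend {k n : ℕ} (t : Fin k ↪ Fin n) (A : Matrix (Bits k) (Bits k) ℂ) :
    Matrix (Bits n) (Bits n) ℂ :=
  open Classical in
  fun x y => if ∀ j, j ∉ Set.range t → x j = y j then A (x ∘ t) (y ∘ t) else 0

theorem extend_one {k n : ℕ} (t : Fin k ↪ Fin n) :
    extend t (1 : Matrix (Bits k) (Bits k) ℂ) = 1 := by
  classical
  ext x y
  by_cases hxy : x = y
  · subst hxy
    simp [extend]
  · rw [Matrix.one_apply_ne hxy]
    unfold extend
    split_ifs with h
    · refine Matrix.one_apply_ne fun h2 => hxy (funext fun j => ?_)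
      by_cases hj : j ∈ Set.range t
      · obtain ⟨i, rfl⟩ := hj
        exact congrFun h2 i
      · exact h j hj
    · rfl

theorem extend_conjTranspose {k n : ℕ} (t : Fin k ↪ Fin n) (A : Matrix (Bits k) (Bits k) ℂ) :
    (extend t A)ᴴ = extend t Aᴴ := by
  classical
  ext x y
  simp only [extend, Matrix.conjTranspose_apply]
  by_cases h : ∀ j, j ∉ Set.range t → y j = x j
  · rw [if_pos h, if_pos fun j hj => (h j hj).symm]
  · rw [if_neg h, if_neg fun h' => h fun j hj => (h' j hj).symm, star_zero]

theorem extend_mul {k n : ℕ} (t : Fin k ↪ Fin n) (A B : Matrix (Bits k) (Bits k) ℂ) :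
    extend t A * extend t B = extend t (A * B) := by
  classical
  ext x y
  rw [Matrix.mul_apply]
  by_cases h : ∀ j, j ∉ Set.range t → x j = y j
  · have hr : extend t (A * B) x y = ∑ w, A (x ∘ t) w * B w (y ∘ t) := by
      simp only [extend, if_pos h, Matrix.mul_apply]
    rw [hr]
    symm
    refine Finset.sum_of_injOn (fun w => Function.extend t w x) ?_ (by simp) ?_ ?_
    · intro w _ w' _ hww
      have h2 := congrArg (fun f : Bits n => f ∘ t) hww
      simpa [Function.extend_comp t.injective] using h2
    · intro z _ hz
      have hz' : ¬ ∀ j, j ∉ Set.range t → x j = z j := by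
        intro hxz
        refine hz ⟨z ∘ t, by simp, funext fun j => ?_⟩
        by_cases hj : j ∈ Set.range t
        · obtain ⟨i, rfl⟩ := hj
          simp [t.injective.extend_apply]
        · simp only
          rw [Function.extend_apply' _ _ _ hj, hxz j hj]
      simp only [extend, if_neg hz', zero_mul]
    · intro w _
      have e1 : ∀ j, j ∉ Set.range t → x j = Function.extend t w x j := fun j hj =>
        (Function.extend_apply' _ _ _ hj).symm
      have e2 : ∀ j, j ∉ Set.range t → Function.extend t w x j = y j := fun j hj =>
        (e1 j hj).symm.trans (h j hj)
      simp only [extend, if_pos e1, if_pos e2, Function.extend_comp t.injective]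
  · have hr : extend t (A * B) x y = 0 := by simp only [extend, if_neg h]
    rw [hr]
    refine Finset.sum_eq_zero fun z _ => ?_
    by_cases h1 : ∀ j, j ∉ Set.range t → x j = z j
    · have h2 : ¬ ∀ j, j ∉ Set.range t → z j = y j := fun h2 =>
        h fun j hj => (h1 j hj).trans (h2 j hj)
      simp only [extend, if_neg h2, mul_zero]
    · simp only [extend, if_neg h1, zero_mul]

/-- An elementary gate of an `n`-qubit circuit: a unitary on `arity` qubits, together with the
(ordered, distinct) qubits of the register on which it is applied. -/
structure Gate (n : ℕ) where
  /-- the number of qubits on which the gate acts -/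
  arity : ℕ
  /-- the qubits on which the gate acts -/
  targets : Fin arity ↪ Fin n
  /-- the unitary of the gate -/
  mat : Matrix.unitaryGroup (Bits arity) ℂ

/-- The unitary operator by which a gate acts on the whole register. -/
def Gate.op {n : ℕ} (g : Gate n) : Matrix.unitaryGroup (Bits n) ℂ :=
  ⟨extend g.targets g.mat.1, by
    rw [Matrix.mem_unitaryGroup_iff, Matrix.star_eq_conjTranspose, extend_conjTranspose,
      extend_mul, ← Matrix.star_eq_conjTranspose, Matrix.mem_unitaryGroup_iff.1 g.mat.2,
      extend_one]⟩

/-- The unitary `g₁ ⋯ g_l` of the circuit `[g₁, …, g_l]`; its number of gates is the length `l`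
of the list. -/
def circuitOp {n : ℕ} (w : List (Gate n)) : Matrix.unitaryGroup (Bits n) ℂ :=
  (w.map Gate.op).prod

/-- A gate set is closed under inversion if it contains the inverse of each of its gates. -/
def ClosedUnderInversion {n : ℕ} (G : Set (Gate n)) : Prop :=
  ∀ g ∈ G, ∃ g' ∈ G, g'.op = g.op⁻¹

/-- A gate set is universal if circuits of gates from it approximate every unitary on the
register to arbitrary precision in operator norm, up to a global phase. -/
def Universal {n : ℕ} (G : Set (Gate n)) : Prop :=
  ∀ U : Matrix.unitaryGroup (Bits n) ℂ, ∀ δ : ℝ, 0 < δ →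
    ∃ w : List (Gate n), (∀ g ∈ w, g ∈ G) ∧
      ∃ θ : ℝ, ‖(circuitOp w).1 - Complex.exp (θ * Complex.I) • U.1‖ < δ

/-- The product state `|0⟩^{⊗ n}`. -/
def zeroState (n : ℕ) : Qubits n := EuclideanSpace.single (fun _ => 0) 1

/-- The action of an operator on a state vector. -/
def act {n : ℕ} (A : Matrix (Bits n) (Bits n) ℂ) (ψ : Qubits n) : Qubits n :=
  Matrix.toEuclideanLin A ψ

/-- The expectation value `⟨ψ|H|ψ⟩` (a real number when `H` is Hermitian). -/
def energy {n : ℕ} (H : Matrix (Bits n) (Bits n) ℂ) (ψ : Qubits n) : ℝ :=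
  (inner ℂ ψ (act H ψ)).re

/-- `E` is the lowest eigenvalue of `H`. -/
def IsGroundEnergy {n : ℕ} (H : Matrix (Bits n) (Bits n) ℂ) (E : ℝ) : Prop :=
  IsLeast {e : ℝ | Module.End.HasEigenvalue (Matrix.toEuclideanLin H) (e : ℂ)} E

/-- `ψ` is a normalized ground state of `H`, with ground-state energy `E`. -/
def IsGroundState {n : ℕ} (H : Matrix (Bits n) (Bits n) ℂ) (E : ℝ) (ψ : Qubits n) : Prop :=
  IsGroundEnergy H E ∧ ‖ψ‖ = 1 ∧ act H ψ = (E : ℂ) • ψ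

end VQE

end

/-! The energy bound is a variational fact: `H - E₀` is symmetric and kills the ground state, so the
energy error is quadratic in the state error. Some unitary sends `|0⟩^{⊗ n}` to the ground state, so
the rest is a Solovay–Kitaev theorem with exponent 4.

Compactness of the unitary group turns universality into one word length that works for all
unitaries at a fixed precision. Precision then improves recursively. If words of length `l` reach
error `s²`, the remaining correction `Δ` is within `s²` of `1`. Up to a phase and `O(s³)` it is a
group commutator of unitaries within `O(s)` of `1`, and errors `s²` in these two factors again cost
only `O(s³)`. Thus `5 * l` gates reach error `r * s³`. The logarithm of the precision grows by
nearly `3/2` per round while the length grows by `5`, and `5 ≤ (3/2)^4`.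

The factors come from solving `Tᴴ * T - T * Tᴴ = H` for traceless Hermitian `H`, by a weighted
cyclic shift in an eigenbasis. -/

section CStar

/-! ### Group commutators and exponentials near the identity -/

variable {E : Type*} [NormedRing E] [StarRing E] [CStarRing E]

/-- With `a = V - 1` and `b = W - 1`, one has `V W V* W* - 1 = (a b - b a) V* W*`. Both `a` and `b`
are `O(s)`, so replacing them by `A`, `B` at cost `O(s²)`, or `V* W*` by `1`, changes the product by
only `O(s³)`. -/
theorem norm_groupCommutator_sub_le {V W A B : E} (hV : V ∈ unitary E) (hW : W ∈ unitary E)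
    {r s : ℝ} (hr : 0 ≤ r) (hs : 0 ≤ s) (hs1 : s ≤ 1)
    (hVA : ‖V - 1 - A‖ ≤ r * s ^ 2) (hWB : ‖W - 1 - B‖ ≤ r * s ^ 2)
    (hA : ‖A‖ ≤ r * s) (hB : ‖B‖ ≤ r * s) :
    ‖V * W * star V * star W - 1 - (A * B - B * A)‖ ≤ (32 * r ^ 3 + 6 * r ^ 2) * s ^ 3 := by
  have hs2 : r * s ^ 2 ≤ r * s := by
    apply mul_le_mul_of_nonneg_left _ hr
    nlinarith
  have near : ∀ X Y : E, ‖X - 1 - Y‖ ≤ r * s ^ 2 → ‖Y‖ ≤ r * s → ‖X - 1‖ ≤ 2 * (r * s) := by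
    intro X Y h1 h2
    calc ‖X - 1‖ = ‖(X - 1 - Y) + Y‖ := by congr 1; abel
      _ ≤ ‖X - 1 - Y‖ + ‖Y‖ := norm_add_le _ _
      _ ≤ 2 * (r * s) := by linarith
  have ha := near V A hVA hA
  have hb := near W B hWB hB
  set a := V - 1 with ha_def
  set b := W - 1 with hb_def
  have hrs : 0 ≤ r * s := mul_nonneg hr hs
  have hrs2 : 0 ≤ r * s ^ 2 := mul_nonneg hr (sq_nonneg s)
  have hVV : V * star V = 1 := (Unitary.mem_iff.1 hV).2
  have hWW : W * star W = 1 := (Unitary.mem_iff.1 hW).2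
  have hWV : W * V * star V * star W = 1 := by
    rw [mul_assoc W, hVV, mul_one, hWW]
  have key : V * W * star V * star W - 1 - (A * B - B * A) =
      (a * b - b * a) * (star V * star W - 1) +
        (((a - A) * b - b * (a - A)) + (A * (b - B) - (b - B) * A)) := by
    have h1 : (a * b - b * a) * (star V * star W) = V * W * star V * star W - 1 := by
      rw [← hWV, ha_def, hb_def]; noncomm_ring
    rw [mul_sub, h1]; noncomm_ring
  have comm : ∀ (X Y : E) (p q : ℝ), ‖X‖ ≤ p → ‖Y‖ ≤ q → ‖X * Y - Y * X‖ ≤ 2 * (p * q) := by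
    intro X Y p q hX hY
    have hp : 0 ≤ p := (norm_nonneg _).trans hX
    have hXY : ‖X * Y‖ ≤ p * q :=
      (norm_mul_le _ _).trans (mul_le_mul hX hY (norm_nonneg _) hp)
    have hYX : ‖Y * X‖ ≤ q * p :=
      (norm_mul_le _ _).trans (mul_le_mul hY hX (norm_nonneg _) ((norm_nonneg _).trans hY))
    calc ‖X * Y - Y * X‖ ≤ ‖X * Y‖ + ‖Y * X‖ := norm_sub_le _ _
      _ ≤ 2 * (p * q) := by linarith
  have hstar : ‖star V * star W - 1‖ ≤ 2 * (r * s) + 2 * (r * s) := by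
    have h2 : star V * star W - 1 = star V * star b + star a := by
      rw [ha_def, hb_def, star_sub, star_sub, star_one]; noncomm_ring
    rw [h2]
    refine (norm_add_le _ _).trans ?_
    rw [CStarRing.norm_mem_unitary_mul _ (Unitary.star_mem hV), norm_star, norm_star]
    exact add_le_add hb ha
  rw [key]
  have e1 := comm a b _ _ ha hb
  have e2 := comm (a - A) b _ _ hVA hb
  have e3 := comm A (b - B) _ _ hA hWB
  have e4 : ‖(a * b - b * a) * (star V * star W - 1)‖ ≤
      2 * (2 * (r * s) * (2 * (r * s))) * (2 * (r * s) + 2 * (r * s)) :=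
    (norm_mul_le _ _).trans (mul_le_mul e1 hstar (norm_nonneg _) (by positivity))
  calc _ ≤ _ := norm_add_le _ _
    _ ≤ _ := add_le_add e4 ((norm_add_le _ _).trans (add_le_add e2 e3))
    _ = _ := by ring

end CStar

theorem norm_exp_sub_one_sub_self_le {E : Type*} [NormedRing E] [NormOneClass E]
    [NormedAlgebra ℂ E] [CompleteSpace E] (A : E) :
    ‖NormedSpace.exp A - 1 - A‖ ≤ ‖A‖ ^ 2 * Real.exp ‖A‖ := by
  have h := NormedSpace.exp_series_hasSum_exp' (𝕂 := ℂ) A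
  have h2 := (hasSum_nat_add_iff' 2).2 h
  simp only [Finset.sum_range_succ, Finset.sum_range_zero, Nat.factorial_zero, Nat.cast_one,
    inv_one, one_smul, pow_zero, zero_add, Nat.factorial_one, pow_one, ← sub_sub] at h2
  have h3 := (NormedSpace.exp_series_hasSum_exp' (𝕂 := ℝ) ‖A‖).mul_left (‖A‖ ^ 2)
  rw [← Real.exp_eq_exp_ℝ] at h3
  rw [← h2.tsum_eq]
  refine tsum_of_norm_bounded h3 fun n => ?_
  rw [norm_smul, norm_inv, Complex.norm_natCast, smul_eq_mul]
  have h4 : ((n + 2).factorial : ℝ)⁻¹ ≤ (n.factorial : ℝ)⁻¹ := by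
    gcongr
    omega
  calc ((n + 2).factorial : ℝ)⁻¹ * ‖A ^ (n + 2)‖ ≤ (n.factorial : ℝ)⁻¹ * ‖A‖ ^ (n + 2) :=
        mul_le_mul h4 (norm_pow_le _ _) (norm_nonneg _) (by positivity)
    _ = _ := by ring

/-- A function of zero sum is a coboundary of a cyclic shift. -/
theorem exists_perm_sub_comp_eq {ι : Type*} [Fintype ι] (d : ι → ℝ) (hd : ∑ i, d i = 0) :
    ∃ (σ : Equiv.Perm ι) (f : ι → ℝ), (∀ i, f i - f (σ i) = d i) ∧
      ∀ i, 0 ≤ f i ∧ f i ≤ 2 * ∑ j, |d j| := by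
  rcases isEmpty_or_nonempty ι with h | h
  · exact ⟨1, 0, fun i => h.elim i, fun i => h.elim i⟩
  obtain ⟨m, hm⟩ : ∃ m, Fintype.card ι = m + 1 :=
    ⟨_, (Nat.succ_pred_eq_of_pos Fintype.card_pos).symm⟩
  let e : ι ≃ Fin (m + 1) := Fintype.equivFinOfCardEq hm
  let D : Fin (m + 1) → ℝ := fun k => d (e.symm k)
  have hD : ∑ k, D k = 0 := by rw [← hd]; exact Equiv.sum_comp e.symm d
  have hDabs : ∑ k, |D k| = ∑ j, |d j| := Equiv.sum_comp e.symm fun j => |d j|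
  -- Partial sums: one step of the shift adds `D k`, and the wrap-around is consistent because the
  -- total is zero.
  let F : Fin (m + 1) → ℝ := fun k => ∑ j ∈ Finset.Iio k, D j
  have hF : ∀ k, |F k| ≤ ∑ j, |d j| := fun k =>
    hDabs ▸ (Finset.abs_sum_le_sum_abs _ _).trans
      (Finset.sum_le_sum_of_subset_of_nonneg (Finset.subset_univ _) fun _ _ _ => abs_nonneg _)
  have hstep : ∀ k, F (finRotate (m + 1) k) - F k = D k := by
    intro k
    rcases Fin.eq_castSucc_or_eq_last k with ⟨j, rfl⟩ | rfl
    · have h1 : finRotate (m + 1) j.castSucc = j.succ := by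
        rw [finRotate_apply, Fin.coeSucc_eq_succ]
      have h2 : Finset.Iio j.succ = insert j.castSucc (Finset.Iio j.castSucc) := by
        ext x
        simp only [Finset.mem_Iio, Finset.mem_insert, Fin.lt_def, Fin.ext_iff, Fin.val_succ,
          Fin.val_castSucc]
        omega
      simp only [F, h1, h2]
      rw [Finset.sum_insert (by simp)]
      ring
    · have h2 : insert (Fin.last m) (Finset.Iio (Fin.last m)) = Finset.univ := by
        ext x
        simp only [Finset.mem_Iio, Finset.mem_insert, Finset.mem_univ, iff_true]
        exact (Fin.le_last x).eq_or_lt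
      rw [← h2, Finset.sum_insert (by simp)] at hD
      have h0 : F (finRotate (m + 1) (Fin.last m)) = 0 := by
        have : Finset.Iio (0 : Fin (m + 1)) = ∅ := by ext x; simp
        simp [F, this]
      rw [h0]
      simp only [F]
      linarith
  -- Subtracting `F` from a bound on `|F|` makes the potential nonnegative, so that it has a square
  -- root later.
  refine ⟨(e.trans (finRotate (m + 1))).trans e.symm, fun i => ∑ j, |d j| - F (e i), ?_, ?_⟩
  · intro i
    have := hstep (e i)
    simp only [Equiv.trans_apply, Equiv.apply_symm_apply, D, Equiv.symm_apply_apply] at this ⊢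
    linarith
  · intro i
    have := abs_le.1 (hF (e i))
    constructor <;> linarith

/-! ### Matrix commutators and the factorization of unitaries near the identity -/

section Matrices

variable {ι : Type*} [Fintype ι] [DecidableEq ι]

/-- For a permutation matrix of `σ` weighted by `√f`, the two products are diagonal with entries `f
i` and `f (σ i)`, so their difference is the coboundary `d`. -/
theorem exists_conjTranspose_mul_sub_eq_diagonal (d : ι → ℝ) (hd : ∑ i, d i = 0) :
    ∃ T : Matrix ι ι ℂ, Tᴴ * T - T * Tᴴ = Matrix.diagonal (fun i => (d i : ℂ)) ∧
      ‖T‖ ^ 2 ≤ 2 * ∑ i, |d i| := by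
  obtain ⟨σ, f, hf, hb⟩ := exists_perm_sub_comp_eq d hd
  let v : ι → ℂ := fun i => (Real.sqrt (f i) : ℂ)
  have hv : ∀ i, v i * v i = f i := fun i => by
    rw [← Complex.ofReal_mul, Real.mul_self_sqrt (hb i).1]
  let T : Matrix ι ι ℂ := Matrix.of fun i j => if σ i = j then v j else 0
  have hstar : ∀ i j, star (T i j) = T i j := fun i j => by
    simp only [T, Matrix.of_apply]
    split_ifs <;> simp [v]
  have h1 : Tᴴ * T = Matrix.diagonal fun i => (f i : ℂ) := by
    ext i j
    rw [Matrix.mul_apply, Matrix.diagonal_apply]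
    simp only [Matrix.conjTranspose_apply, hstar]
    have := Equiv.sum_comp σ fun k => (if k = i then v i else 0) * (if k = j then v j else 0)
    simp only [T, Matrix.of_apply]
    rw [this]
    by_cases hij : i = j
    · subst hij; simp [hv]
    · simp [hij, Ne.symm hij]
  have h2 : T * Tᴴ = Matrix.diagonal fun i => (f (σ i) : ℂ) := by
    ext i j
    rw [Matrix.mul_apply, Matrix.diagonal_apply]
    simp only [Matrix.conjTranspose_apply, hstar]
    simp only [T, Matrix.of_apply]
    by_cases hij : i = j
    · subst hij; simp [hv]
    · simp [hij]
  refine ⟨T, ?_, ?_⟩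
  · rw [h1, h2, Matrix.diagonal_sub]
    congr 1
    ext i
    rw [← hf i]
    push_cast
    rfl
  · rw [sq, ← Matrix.l2_opNorm_conjTranspose_mul_self, h1, Matrix.l2_opNorm_diagonal]
    refine (pi_norm_le_iff_of_nonneg (by positivity)).2 fun i => ?_
    rw [Complex.norm_real, Real.norm_of_nonneg (hb i).1]
    exact (hb i).2

theorem Matrix.IsHermitian.abs_eigenvalues_le {H : Matrix ι ι ℂ} (hH : H.IsHermitian) (i : ι) :
    |hH.eigenvalues i| ≤ ‖H‖ := by
  have h := hH.spectral_theorem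
  rw [Unitary.conjStarAlgAut_apply] at h
  have h2 : ‖H‖ = ‖(fun i => (hH.eigenvalues i : ℂ))‖ := by
    rw [← Matrix.l2_opNorm_diagonal]
    conv_lhs => rw [h]
    rw [← Unitary.coe_star, CStarRing.norm_mul_coe_unitary, CStarRing.norm_coe_unitary_mul]
    rfl
  rw [h2]
  simpa using norm_le_pi_norm (fun i => (hH.eigenvalues i : ℂ)) i

theorem Matrix.IsHermitian.exists_conjTranspose_mul_sub_eq {H : Matrix ι ι ℂ}
    (hH : H.IsHermitian) (htr : H.trace = 0) :
    ∃ T : Matrix ι ι ℂ, Tᴴ * T - T * Tᴴ = H ∧ ‖T‖ ^ 2 ≤ 2 * (Fintype.card ι * ‖H‖) := by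
  have hd : ∑ i, hH.eigenvalues i = 0 := by
    rw [hH.trace_eq_sum_eigenvalues] at htr
    rw [← Complex.ofReal_eq_zero, ← htr, Complex.ofReal_sum]
    rfl
  obtain ⟨T, hT, hn⟩ := exists_conjTranspose_mul_sub_eq_diagonal _ hd
  have h := hH.spectral_theorem
  rw [Unitary.conjStarAlgAut_apply] at h
  set U := hH.eigenvectorUnitary
  have hU : (star U : Matrix ι ι ℂ) * (U : Matrix ι ι ℂ) = 1 := Unitary.coe_star_mul_self U
  refine ⟨(U : Matrix ι ι ℂ) * T * (star U : Matrix ι ι ℂ), ?_, ?_⟩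
  · rw [← Matrix.star_eq_conjTranspose] at hT ⊢
    conv_rhs => rw [h]
    have : Matrix.diagonal (RCLike.ofReal ∘ hH.eigenvalues) = star T * T - T * star T := hT.symm
    rw [this]
    simp only [star_mul, star_star, mul_sub, sub_mul, mul_assoc]
    simp only [← mul_assoc (star (U : Matrix ι ι ℂ)) (U : Matrix ι ι ℂ), hU, one_mul]
  · rw [← Unitary.coe_star, CStarRing.norm_mul_coe_unitary, CStarRing.norm_coe_unitary_mul]
    refine hn.trans ?_
    gcongr
    refine (Finset.sum_le_card_nsmul _ _ ‖H‖ fun i _ => hH.abs_eigenvalues_le i).trans_eq ?_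
    simp

/-- A traceless skew-Hermitian matrix is a commutator of skew-Hermitian matrices of comparable
size. -/
theorem Matrix.IsHermitian.exists_skewAdjoint_commutator_eq {H : Matrix ι ι ℂ}
    (hH : H.IsHermitian) (htr : H.trace = 0) {s : ℝ} (hs : 0 ≤ s) (hHs : ‖H‖ ≤ 2 * s ^ 2) :
    ∃ A ∈ skewAdjoint (Matrix ι ι ℂ), ∃ B ∈ skewAdjoint (Matrix ι ι ℂ),
      A * B - B * A = Complex.I • H ∧
      ‖A‖ ≤ 2 * (Fintype.card ι + 1) * s ∧ ‖B‖ ≤ 2 * (Fintype.card ι + 1) * s := by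
  have hH2 : ((1 / 2 : ℝ) • H).IsHermitian := by
    rw [Matrix.IsHermitian, Matrix.conjTranspose_smul, hH.eq, star_trivial]
  obtain ⟨T, hT, hn⟩ := hH2.exists_conjTranspose_mul_sub_eq
    (by rw [Matrix.trace_smul, htr, smul_zero])
  have hT' : H = (2 : ℂ) • (star T * T - T * star T) := by
    rw [Matrix.star_eq_conjTranspose, hT, ← Complex.coe_smul, smul_smul]
    norm_num
  have hTn : ‖T‖ ≤ (Fintype.card ι + 1) * s := by
    refine abs_le_of_sq_le_sq' ?_ (by positivity) |>.2
    refine hn.trans ?_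
    rw [norm_smul, Real.norm_of_nonneg (by norm_num)]
    have : (0 : ℝ) ≤ Fintype.card ι := by positivity
    nlinarith [mul_le_mul_of_nonneg_left hHs this, sq_nonneg s, mul_nonneg this (sq_nonneg s),
      mul_nonneg (mul_nonneg this this) (sq_nonneg s)]
  have hTs : ‖star T‖ ≤ (Fintype.card ι + 1) * s := by rwa [norm_star]
  refine ⟨Complex.I • (T + star T), ?_, T - star T, ?_, ?_, ?_, ?_⟩
  · rw [skewAdjoint.mem_iff, star_smul, star_add, star_star, add_comm, ← neg_smul]
    simp
  · rw [skewAdjoint.mem_iff, star_sub, star_star, neg_sub]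
  · rw [hT', smul_mul_assoc, mul_smul_comm, ← smul_sub]
    congr 1
    rw [two_smul]
    noncomm_ring
  · rw [norm_smul, Complex.norm_I, one_mul]
    exact (norm_add_le _ _).trans (by linarith)
  · exact (norm_sub_le _ _).trans (by linarith)

/-- A unitary close to `1` is, up to a phase, a group commutator to higher order, and this is
robust against perturbations of the two factors. -/
theorem exists_unitary_groupCommutator_near [Nonempty ι] :
    ∃ r : ℝ, ∀ s : ℝ, 0 ≤ s → s ≤ 1 → ∀ Δ ∈ Matrix.unitaryGroup ι ℂ, ‖Δ - 1‖ ≤ s ^ 2 →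
      ∃ V ∈ Matrix.unitaryGroup ι ℂ, ∃ W ∈ Matrix.unitaryGroup ι ℂ, ∃ t : ℝ,
        ∀ V' ∈ Matrix.unitaryGroup ι ℂ, ∀ W' ∈ Matrix.unitaryGroup ι ℂ,
          ‖V' - V‖ ≤ s ^ 2 → ‖W' - W‖ ≤ s ^ 2 →
            ‖V' * W' * star V' * star W' - Complex.exp (t * Complex.I) • Δ‖ ≤ r * s ^ 3 := by
  set q : ℝ := 2 * (Fintype.card ι + 1) with hq
  have hq2 : 2 ≤ q := by
    have : (0 : ℝ) ≤ Fintype.card ι := by positivity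
    linarith
  set p : ℝ := q ^ 2 * Real.exp q + 1 + q with hp
  have hexp : 0 < Real.exp q := Real.exp_pos q
  have hp0 : 0 ≤ p := by positivity
  refine ⟨32 * p ^ 3 + 6 * p ^ 2 + 3, fun s hs hs1 Δ hΔ hΔs => ?_⟩
  have hs2 : s ^ 2 ≤ 1 := pow_le_one₀ hs hs1
  obtain ⟨hΔ1, hΔ2⟩ := Unitary.mem_iff.1 hΔ
  -- The imaginary part of `Δ` stands in for its logarithm: unitarity gives `Δ - 1 - iH = -(Δ - 1)*
  -- (Δ - 1) / 2`, which is quadratically small.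
  let H : Matrix ι ι ℂ := (-Complex.I / 2) • (Δ - star Δ)
  have hH : H.IsHermitian := by
    change star H = H
    simp only [H, star_smul, star_sub, star_star]
    rw [← neg_sub Δ (star Δ), smul_neg, ← neg_smul]
    congr 1
    simp [neg_div]
  have hIH : Δ - 1 - Complex.I • H = - ((1 / 2 : ℂ) • (star (Δ - 1) * (Δ - 1))) := by
    have h1 : star (Δ - 1) * (Δ - 1) = (2 : ℂ) • 1 - Δ - star Δ := by
      rw [star_sub, star_one, sub_mul, mul_sub, hΔ1, two_smul]
      noncomm_ring
    have h2 : Complex.I • H = (1 / 2 : ℂ) • (Δ - star Δ) := by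
      simp only [H, smul_smul]
      congr 1
      rw [mul_div_assoc', mul_neg, Complex.I_mul_I, neg_neg]
    rw [h1, h2]
    module
  have hHs : ‖H‖ ≤ s ^ 2 := by
    have h1 : Δ - star Δ = (Δ - 1) - star (Δ - 1) := by
      rw [star_sub, star_one]; abel
    have h2 : ‖Δ - star Δ‖ ≤ s ^ 2 + s ^ 2 := by
      rw [h1]
      refine (norm_sub_le _ _).trans ?_
      rw [norm_star]
      exact add_le_add hΔs hΔs
    rw [norm_smul, norm_div, norm_neg, Complex.norm_I, Complex.norm_ofNat]
    linarith
  have hquad : ‖Δ - 1 - Complex.I • H‖ ≤ s ^ 4 := by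
    rw [hIH, norm_neg, norm_smul, CStarRing.norm_star_mul_self]
    have : ‖(1 / 2 : ℂ)‖ = 1 / 2 := by norm_num
    rw [this]
    nlinarith [mul_le_mul hΔs hΔs (norm_nonneg _) (sq_nonneg s), norm_nonneg (Δ - 1)]
  clear_value H
  -- A commutator has trace zero, so the mean eigenvalue `t` is split off and absorbed into the
  -- phase `e^{-it}`.
  obtain ⟨t, ht, htr⟩ : ∃ t : ℝ, |t| ≤ s ^ 2 ∧ (H - (t : ℂ) • 1).trace = 0 := by
    have hc : (0 : ℝ) < Fintype.card ι := by exact_mod_cast Fintype.card_pos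
    refine ⟨(∑ i, hH.eigenvalues i) / Fintype.card ι, ?_, ?_⟩
    · rw [abs_div, abs_of_pos hc, div_le_iff₀ hc]
      refine (Finset.abs_sum_le_sum_abs _ _).trans ?_
      refine (Finset.sum_le_card_nsmul _ _ (s ^ 2)
        fun i _ => (hH.abs_eigenvalues_le i).trans hHs).trans_eq ?_
      simp [mul_comm]
    · have hc' : (Fintype.card ι : ℂ) ≠ 0 := by exact_mod_cast hc.ne'
      rw [Matrix.trace_sub, Matrix.trace_smul, Matrix.trace_one, smul_eq_mul,
        hH.trace_eq_sum_eigenvalues, Complex.ofReal_div, Complex.ofReal_sum, Complex.ofReal_natCast,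
        div_mul_cancel₀ _ hc', sub_eq_zero]
      rfl
  have hone : ‖(1 : Matrix ι ι ℂ)‖ = 1 := CStarRing.norm_one
  have hH0 : (H - (t : ℂ) • 1).IsHermitian := by
    refine hH.sub ?_
    change star _ = _
    simp
  have hH0s : ‖H - (t : ℂ) • 1‖ ≤ 2 * s ^ 2 := by
    refine (norm_sub_le _ _).trans ?_
    rw [norm_smul, hone, Complex.norm_real, Real.norm_eq_abs]
    linarith
  obtain ⟨A, hA, B, hB, hAB, hAn, hBn⟩ := hH0.exists_skewAdjoint_commutator_eq htr hs hH0s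
  have hexpA : ∀ X : Matrix ι ι ℂ, ‖X‖ ≤ q * s → ∀ X', ‖X' - NormedSpace.exp X‖ ≤ s ^ 2 →
      ‖X' - 1 - X‖ ≤ p * s ^ 2 := by
    intro X hX X' hX'
    have h1 := norm_exp_sub_one_sub_self_le X
    have h2 : ‖X‖ ^ 2 * Real.exp ‖X‖ ≤ (q * s) ^ 2 * Real.exp q := by
      gcongr
      exact hX.trans (mul_le_of_le_one_right (by positivity) hs1)
    calc ‖X' - 1 - X‖ = ‖(X' - NormedSpace.exp X) + (NormedSpace.exp X - 1 - X)‖ := by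
          congr 1; abel
      _ ≤ s ^ 2 + (q * s) ^ 2 * Real.exp q := (norm_add_le _ _).trans (add_le_add hX' (h1.trans h2))
      _ ≤ p * s ^ 2 := by
          rw [hp]
          nlinarith [mul_nonneg (by linarith : 0 ≤ q) (sq_nonneg s)]
  have hqs : q * s ≤ p * s := by
    refine mul_le_mul_of_nonneg_right ?_ hs
    rw [hp]
    nlinarith [mul_pos (by positivity : 0 < q ^ 2) hexp]
  let _ : NormedAlgebra ℚ (Matrix ι ι ℂ) := .restrictScalars ℚ ℂ _
  refine ⟨NormedSpace.exp A, NormedSpace.exp_mem_unitary_of_mem_skewAdjoint hA,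
    NormedSpace.exp B, NormedSpace.exp_mem_unitary_of_mem_skewAdjoint hB, -t,
    fun V' hV' W' hW' hV hW => ?_⟩
  have hcomm := norm_groupCommutator_sub_le hV' hW' hp0 hs hs1 (hexpA A hAn V' hV)
    (hexpA B hBn W' hW) (hAn.trans hqs) (hBn.trans hqs)
  rw [hAB] at hcomm
  set z : ℂ := Complex.exp (((-t : ℝ) : ℂ) * Complex.I) with hz
  have hz1 : ‖z - 1‖ ≤ s ^ 2 := by
    have := Real.norm_exp_I_mul_ofReal_sub_one_le (x := -t)
    rw [mul_comm, ← hz, norm_neg, Real.norm_eq_abs] at this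
    exact this.trans ht
  have hz2 : ‖z - 1 + t * Complex.I‖ ≤ s ^ 4 := by
    have hn : ‖((-t : ℝ) : ℂ) * Complex.I‖ = |t| := by simp
    have := Complex.norm_exp_sub_one_sub_id_le (x := ((-t : ℝ) : ℂ) * Complex.I)
      (by rw [hn]; linarith)
    rw [← hz, hn] at this
    have h2 : z - 1 + t * Complex.I = z - 1 - ((-t : ℝ) : ℂ) * Complex.I := by
      push_cast; ring
    rw [h2]
    refine this.trans ?_
    nlinarith [abs_nonneg t]
  have hphase : ‖1 + Complex.I • (H - (t : ℂ) • 1) - z • Δ‖ ≤ 3 * s ^ 3 := by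
    -- Each of the three remainders is at most `s^4 ≤ s^3`.
    have h1 : 1 + Complex.I • (H - (t : ℂ) • 1) - z • Δ =
        -((z - 1 + t * Complex.I) • 1 + (z - 1) • (Δ - 1) + (Δ - 1 - Complex.I • H)) := by
      module
    rw [h1, norm_neg]
    refine (norm_add₃_le ..).trans ?_
    rw [norm_smul, norm_smul, hone]
    have h2 := mul_le_mul hz1 hΔs (norm_nonneg _) (sq_nonneg s)
    have h3 : s ^ 4 ≤ s ^ 3 := pow_le_pow_of_le_one hs hs1 (by norm_num)
    nlinarith
  calc ‖V' * W' * star V' * star W' - z • Δ‖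
      = ‖(V' * W' * star V' * star W' - 1 - Complex.I • (H - (t : ℂ) • 1)) +
          (1 + Complex.I • (H - (t : ℂ) • 1) - z • Δ)‖ := by congr 1; abel
    _ ≤ _ := (norm_add_le _ _).trans (add_le_add hcomm hphase)
    _ = _ := by ring

theorem Matrix.isCompact_unitaryGroup :
    IsCompact (Matrix.unitaryGroup ι ℂ : Set (Matrix ι ι ℂ)) := by
  have : ProperSpace (Matrix ι ι ℂ) := FiniteDimensional.proper ℂ _
  refine Metric.isCompact_of_isClosed_isBounded isClosed_unitary ?_
  refine (Metric.isBounded_closedBall (x := 0) (r := ‖(1 : Matrix ι ι ℂ)‖)).subset fun U hU => ?_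
  rw [mem_closedBall_zero_iff, ← CStarRing.norm_mem_unitary_mul (1 : Matrix ι ι ℂ) hU, mul_one]

end Matrices

/-! ### Circuits and the Solovay–Kitaev recursion -/

namespace VQE

variable {n : ℕ}

theorem circuitOp_append (w w' : List (Gate n)) :
    circuitOp (w ++ w') = circuitOp w * circuitOp w' := by
  simp [circuitOp]

theorem ClosedUnderInversion.exists_circuitOp_eq_inv {G : Set (Gate n)}
    (hG : ClosedUnderInversion G) (w : List (Gate n)) (hw : ∀ g ∈ w, g ∈ G) :
    ∃ w' : List (Gate n), (∀ g ∈ w', g ∈ G) ∧ w'.length = w.length ∧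
      circuitOp w' = (circuitOp w)⁻¹ := by
  induction w with
  | nil => exact ⟨[], by simp, rfl, by simp [circuitOp]⟩
  | cons g w ih =>
    obtain ⟨w', h1, h2, h3⟩ := ih fun x hx => hw x (List.mem_cons_of_mem _ hx)
    obtain ⟨g', hg', hop⟩ := hG g (hw g List.mem_cons_self)
    refine ⟨w' ++ [g'], ?_, by simp [h2], ?_⟩
    · intro x hx
      rcases List.mem_append.1 hx with h | h
      · exact h1 x h
      · rw [List.mem_singleton.1 h]; exact hg'
    · rw [circuitOp_append, h3]
      simp [circuitOp, hop]

/-- Some circuit of at most `l` gates from `G` implements `U` up to a global phase and an error of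
at most `δ`. -/
def HasApprox (G : Set (Gate n)) (l : ℕ) (δ : ℝ) (U : Matrix (Bits n) (Bits n) ℂ) : Prop :=
  ∃ w : List (Gate n), (∀ g ∈ w, g ∈ G) ∧ w.length ≤ l ∧
    ∃ θ : ℝ, ‖Complex.exp (θ * Complex.I) • (circuitOp w).1 - U‖ ≤ δ

theorem norm_exp_smul_sub (θ : ℝ) (A B : Matrix (Bits n) (Bits n) ℂ) :
    ‖A - Complex.exp (θ * Complex.I) • B‖ =
      ‖Complex.exp ((-θ : ℝ) * Complex.I) • A - B‖ := by
  have h : Complex.exp ((-θ : ℝ) * Complex.I) • A - B =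
      Complex.exp ((-θ : ℝ) * Complex.I) • (A - Complex.exp (θ * Complex.I) • B) := by
    rw [smul_sub, smul_smul, ← Complex.exp_add]
    simp
  rw [h, norm_smul, Complex.norm_exp_ofReal_mul_I, one_mul]

theorem smul_mem_unitaryGroup (θ : ℝ) (U : Matrix.unitaryGroup (Bits n) ℂ) :
    Complex.exp (θ * Complex.I) • U.1 ∈ Matrix.unitaryGroup (Bits n) ℂ := by
  have h : star (Complex.exp (θ * Complex.I)) * Complex.exp (θ * Complex.I) = 1 := by
    rw [← Complex.ofReal_one, ← one_pow 2, ← Complex.norm_exp_ofReal_mul_I θ,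
      Complex.ofReal_pow, ← Complex.conj_mul']
    rfl
  rw [Matrix.mem_unitaryGroup_iff', star_smul, smul_mul_smul_comm, h, one_smul]
  exact Matrix.mem_unitaryGroup_iff'.1 U.2

/-- A word within `δ / 2` of `U` serves the whole ball of radius `δ / 2` around `U`; finitely many
such balls cover the compact unitary group. -/
theorem Universal.exists_uniform_hasApprox {G : Set (Gate n)} (hG : Universal G) {δ : ℝ}
    (hδ : 0 < δ) : ∃ l : ℕ, ∀ U ∈ Matrix.unitaryGroup (Bits n) ℂ, HasApprox G l δ U := by
  refine Matrix.isCompact_unitaryGroup.induction_on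
    (p := fun s => ∃ l : ℕ, ∀ U ∈ s, HasApprox G l δ U) ⟨0, by simp⟩ ?_ ?_ ?_
  · rintro s t hst ⟨l, hl⟩
    exact ⟨l, fun U hU => hl U (hst hU)⟩
  · rintro s t ⟨l, hl⟩ ⟨l', hl'⟩
    refine ⟨max l l', fun U hU => ?_⟩
    rcases hU with hU | hU
    · obtain ⟨w, h1, h2, h3⟩ := hl U hU
      exact ⟨w, h1, h2.trans (le_max_left _ _), h3⟩
    · obtain ⟨w, h1, h2, h3⟩ := hl' U hU
      exact ⟨w, h1, h2.trans (le_max_right _ _), h3⟩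
  · intro U hU
    obtain ⟨w, hw, θ, hθ⟩ := hG ⟨U, hU⟩ (δ / 2) (half_pos hδ)
    refine ⟨Metric.ball U (δ / 2),
      mem_nhdsWithin_of_mem_nhds (Metric.ball_mem_nhds _ (half_pos hδ)), w.length,
      fun U' hU' => ⟨w, hw, le_rfl, -θ, ?_⟩⟩
    rw [norm_exp_smul_sub] at hθ
    rw [Metric.mem_ball, dist_comm, dist_eq_norm] at hU'
    refine (norm_sub_le_norm_sub_add_norm_sub _ U _).trans ?_
    linarith

/-- One round of the Solovay–Kitaev recursion. -/
theorem exists_hasApprox_refine (n : ℕ) : ∃ r : ℝ, ∀ G : Set (Gate n), ClosedUnderInversion G →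
    ∀ (s : ℝ) (l : ℕ), 0 ≤ s → s ≤ 1 →
      (∀ U ∈ Matrix.unitaryGroup (Bits n) ℂ, HasApprox G l (s ^ 2) U) →
        ∀ U ∈ Matrix.unitaryGroup (Bits n) ℂ, HasApprox G (5 * l) (r * s ^ 3) U := by
  obtain ⟨r, hr⟩ := exists_unitary_groupCommutator_near (ι := Bits n)
  refine ⟨r, fun G hG s l hs hs1 h U hU => ?_⟩
  obtain ⟨w₀, hw₀, hl₀, θ₀, h₀⟩ := h U hU
  have hX := smul_mem_unitaryGroup θ₀ (circuitOp w₀)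
  set X := Complex.exp (θ₀ * Complex.I) • (circuitOp w₀).1 with hXdef
  have hXX : star X * X = 1 := Matrix.mem_unitaryGroup_iff'.1 hX
  have hXX' : X * star X = 1 := Matrix.mem_unitaryGroup_iff.1 hX
  -- Write `U = Δ X` with `X` the current approximation; only `Δ = U X*` needs correcting.
  have hΔ : ‖U * star X - 1‖ ≤ s ^ 2 := by
    rw [← hXX', ← sub_mul, CStarRing.norm_mul_mem_unitary _ (Unitary.star_mem hX), norm_sub_rev]
    exact h₀
  obtain ⟨V, hV, W, hW, t, ht⟩ := hr s hs hs1 _ (mul_mem hU (Unitary.star_mem hX)) hΔ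
  obtain ⟨w₁, hw₁, hl₁, θ₁, h₁⟩ := h V hV
  obtain ⟨w₂, hw₂, hl₂, θ₂, h₂⟩ := h W hW
  obtain ⟨w₃, hw₃, hl₃, h₃⟩ := hG.exists_circuitOp_eq_inv w₁ hw₁
  obtain ⟨w₄, hw₄, hl₄, h₄⟩ := hG.exists_circuitOp_eq_inv w₂ hw₂
  have h5 := ht _ (smul_mem_unitaryGroup θ₁ (circuitOp w₁)) _
    (smul_mem_unitaryGroup θ₂ (circuitOp w₂)) h₁ h₂
  refine ⟨w₁ ++ w₂ ++ w₃ ++ w₄ ++ w₀, ?_, ?_, θ₀ - t, ?_⟩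
  · intro g hg
    simp only [List.mem_append] at hg
    rcases hg with (((hg | hg) | hg) | hg) | hg
    exacts [hw₁ g hg, hw₂ g hg, hw₃ g hg, hw₄ g hg, hw₀ g hg]
  · simp only [List.length_append]
    omega
  · have hph : ∀ θ : ℝ, Complex.exp (θ * Complex.I) * star (Complex.exp (θ * Complex.I)) = 1 := by
      intro θ
      rw [← Complex.ofReal_one, ← one_pow 2, ← Complex.norm_exp_ofReal_mul_I θ,
        Complex.ofReal_pow, ← Complex.mul_conj']
      rfl
    -- Each phase meets its conjugate in the group commutator, so the phases of `w₁` and `w₂`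
    -- cancel.
    have hcomm : Complex.exp (θ₁ * Complex.I) • (circuitOp w₁).1 *
        Complex.exp (θ₂ * Complex.I) • (circuitOp w₂).1 *
        star (Complex.exp (θ₁ * Complex.I) • (circuitOp w₁).1) *
        star (Complex.exp (θ₂ * Complex.I) • (circuitOp w₂).1) =
        (circuitOp (w₁ ++ w₂ ++ w₃ ++ w₄)).1 := by
      simp only [circuitOp_append, h₃, h₄, star_smul, smul_mul_assoc, mul_smul_comm, smul_smul]
      have : star (Complex.exp (θ₂ * Complex.I)) * (star (Complex.exp (θ₁ * Complex.I)) *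
          (Complex.exp (θ₂ * Complex.I) * Complex.exp (θ₁ * Complex.I))) = 1 := by
        linear_combination (star (Complex.exp (θ₂ * Complex.I)) * Complex.exp (θ₂ * Complex.I)) *
          hph θ₁ + hph θ₂
      rw [this, one_smul]
      rfl
    rw [hcomm] at h5
    have h6 : Complex.exp ((θ₀ - t : ℝ) * Complex.I) •
          (circuitOp (w₁ ++ w₂ ++ w₃ ++ w₄ ++ w₀)).1 - U =
        Complex.exp ((-t : ℝ) * Complex.I) •
          (((circuitOp (w₁ ++ w₂ ++ w₃ ++ w₄)).1 -
            Complex.exp (t * Complex.I) • (U * star X)) * X) := by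
      rw [sub_mul, smul_mul_assoc, mul_assoc U, hXX, mul_one, smul_sub, smul_smul,
        ← Complex.exp_add, hXdef, mul_smul_comm, smul_smul, ← Complex.exp_add, circuitOp_append]
      congr 1
      · congr 1
        congr 1
        push_cast
        ring
      · simp
    rw [h6, norm_smul, Complex.norm_exp_ofReal_mul_I, one_mul, CStarRing.norm_mul_mem_unitary _ hX]
    exact h5

/-- **Solovay–Kitaev theorem** with exponent `4`. -/
theorem Universal.exists_hasApprox_log_pow {G : Set (Gate n)} (hG : Universal G)
    (hG' : ClosedUnderInversion G) : ∃ C : ℝ, ∀ ε : ℝ, 0 < ε → ∃ l : ℕ,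
      (∀ U ∈ Matrix.unitaryGroup (Bits n) ℂ, HasApprox G l ε U) ∧
        (ε ≤ 1 / 2 → (l : ℝ) ≤ C * Real.log (1 / ε) ^ 4) := by
  obtain ⟨r, hr⟩ := exists_hasApprox_refine n
  set K : ℝ := max r 1
  have hK : 1 ≤ K := le_max_right _ _
  have hK0 : 0 < K := by linarith
  -- Chosen to solve `K * s k ^ 3 = s (k + 1) ^ 2` exactly, with error `s k ^ 2 = exp (-(3/2)^k) / K
  -- ^ 2`.
  let s : ℕ → ℝ := fun k => Real.exp (-(3 / 2) ^ k / 2) / K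
  have hs0 : ∀ k, 0 < s k := fun k => by positivity
  have hexp1 : ∀ k : ℕ, Real.exp (-(3 / 2) ^ k / 2) ≤ 1 := fun k => by
    rw [Real.exp_le_one_iff]
    have : (0 : ℝ) ≤ (3 / 2) ^ k := by positivity
    linarith
  have hs1 : ∀ k, s k ≤ 1 := fun k => (div_le_one hK0).2 ((hexp1 k).trans hK)
  have hstep : ∀ k, K * s k ^ 3 = s (k + 1) ^ 2 := by
    intro k
    have h1 : Real.exp (-(3 / 2) ^ k / 2) ^ 3 = Real.exp (-(3 / 2) ^ (k + 1) / 2) ^ 2 := by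
      rw [← Real.exp_nat_mul, ← Real.exp_nat_mul]
      congr 1
      push_cast
      ring
    have h2 : ∀ x y : ℝ, x ^ 3 = y ^ 2 → K * (x / K) ^ 3 = (y / K) ^ 2 := by
      intro x y h
      rw [div_pow, div_pow, h]
      field_simp
    exact h2 _ _ h1
  obtain ⟨l₀, hl₀⟩ := hG.exists_uniform_hasApprox (pow_pos (hs0 0) 2)
  have hmain : ∀ k, ∀ U ∈ Matrix.unitaryGroup (Bits n) ℂ, HasApprox G (5 ^ k * l₀) (s k ^ 2) U := by
    intro k
    induction k with
    | zero => simpa using hl₀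
    | succ k ih =>
      intro U hU
      obtain ⟨w, h1, h2, θ, h3⟩ := hr G hG' (s k) _ (hs0 k).le (hs1 k) ih U hU
      refine ⟨w, h1, h2.trans_eq (by ring), θ, h3.trans ?_⟩
      rw [← hstep]
      exact mul_le_mul_of_nonneg_right (le_max_left _ _) (pow_pos (hs0 k) 3).le
  have hmain' : ∀ (k : ℕ) (ε : ℝ), 0 < ε → Real.log (1 / ε) ≤ (3 / 2) ^ k →
      ∀ U ∈ Matrix.unitaryGroup (Bits n) ℂ, HasApprox G (5 ^ k * l₀) ε U := by
    intro k ε hε hk U hU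
    obtain ⟨w, h1, h2, θ, h3⟩ := hmain k U hU
    refine ⟨w, h1, h2, θ, h3.trans ?_⟩
    have h4 : s k ^ 2 = Real.exp (-(3 / 2) ^ k) / K ^ 2 := by
      simp only [s, div_pow]
      rw [← Real.exp_nat_mul]
      congr 2
      push_cast
      ring
    have h5 : Real.exp (-(3 / 2) ^ k) ≤ ε := by
      rw [← Real.le_log_iff_exp_le hε]
      rw [one_div, Real.log_inv] at hk
      linarith
    rw [h4]
    refine (div_le_self (Real.exp_pos _).le (one_le_pow₀ hK)).trans h5
  have hlog2 : 0 < Real.log 2 := Real.log_pos one_lt_two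
  -- The `5` pays for rounding up to a whole round; `(log 2)^{-4}` covers `log (1 / ε) < 1`, where
  -- no round is needed and `ε ≤ 1 / 2` keeps the logarithm at least `log 2`.
  refine ⟨l₀ * (5 + (Real.log 2 ^ 4)⁻¹), fun ε hε => ?_⟩
  rcases le_or_gt 1 (Real.log (1 / ε)) with h | h
  · obtain ⟨k, hk1, hk2⟩ := exists_nat_pow_near h (by norm_num : (1 : ℝ) < 3 / 2)
    refine ⟨5 ^ (k + 1) * l₀, hmain' _ ε hε hk2.le, fun _ => ?_⟩
    -- The exponent 4 enters here, through `5 ≤ (3/2)^4 = 81/16`.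
    have h1 : ((5 : ℝ)) ^ k ≤ Real.log (1 / ε) ^ 4 := by
      calc (5 : ℝ) ^ k ≤ ((3 / 2) ^ 4) ^ k := by gcongr; norm_num
        _ = ((3 / 2) ^ k) ^ 4 := by rw [← pow_mul, ← pow_mul, mul_comm]
        _ ≤ _ := by gcongr
    have h2 : (0 : ℝ) ≤ l₀ * (Real.log 2 ^ 4)⁻¹ * Real.log (1 / ε) ^ 4 := by positivity
    have h3 : (0 : ℝ) ≤ l₀ := by positivity
    push_cast
    rw [pow_succ]
    nlinarith [mul_le_mul_of_nonneg_left h1 h3]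
  · refine ⟨5 ^ 0 * l₀, hmain' _ ε hε (by simpa using h.le), fun hε2 => ?_⟩
    have h1 : Real.log 2 ≤ Real.log (1 / ε) := by
      refine Real.log_le_log two_pos ?_
      rw [le_div_iff₀ hε]
      linarith
    have h2 : 1 ≤ (Real.log 2 ^ 4)⁻¹ * Real.log (1 / ε) ^ 4 := by
      rw [inv_mul_eq_div, one_le_div (by positivity)]
      gcongr
    have h3 : (0 : ℝ) ≤ l₀ := by positivity
    have h4 : 0 ≤ Real.log (1 / ε) ^ 4 := by positivity
    push_cast
    nlinarith [mul_nonneg h3 h4, mul_le_mul_of_nonneg_left h2 h3]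

/-! ### State preparation and the energy error -/

theorem norm_act_le (A : Matrix (Bits n) (Bits n) ℂ) (ψ : Qubits n) :
    ‖act A ψ‖ ≤ ‖A‖ * ‖ψ‖ :=
  Matrix.l2_opNorm_mulVec A ψ

theorem norm_act_unitary (U : Matrix.unitaryGroup (Bits n) ℂ) (ψ : Qubits n) :
    ‖act U.1 ψ‖ = ‖ψ‖ := by
  have h : ∀ V : Matrix.unitaryGroup (Bits n) ℂ, ∀ φ, ‖act V.1 φ‖ ≤ ‖φ‖ := fun V φ => by
    have := norm_act_le V.1 φ
    rwa [CStarRing.norm_coe_unitary, one_mul] at this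
  refine le_antisymm (h U ψ) ?_
  have h2 : act (U⁻¹).1 (act U.1 ψ) = ψ := by
    have h3 : (U⁻¹).1 * U.1 = 1 := Unitary.coe_star_mul_self U
    simp only [act, Matrix.toLpLin_apply, Matrix.mulVec_mulVec, h3, Matrix.one_mulVec]
  calc ‖ψ‖ = ‖act (U⁻¹).1 (act U.1 ψ)‖ := by rw [h2]
    _ ≤ _ := h _ _

theorem norm_zeroState : ‖zeroState n‖ = 1 := by
  simp [zeroState]

/-- Extend `ψ` to an orthonormal basis with `ψ` at the label `0`; the change-of-basis matrix is the
unitary. -/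
theorem exists_act_zeroState_eq {ψ : Qubits n} (hψ : ‖ψ‖ = 1) :
    ∃ U ∈ Matrix.unitaryGroup (Bits n) ℂ, act U (zeroState n) = ψ := by
  have hv : Orthonormal ℂ (({fun _ => 0} : Set (Bits n)).domRestrict fun _ => ψ) := by
    refine ⟨fun _ => hψ, fun i j hij => (hij (Subsingleton.elim _ _)).elim⟩
  obtain ⟨b, hb⟩ := hv.exists_orthonormalBasis_extension_of_card_eq (by simp)
  refine ⟨_, (EuclideanSpace.basisFun (Bits n) ℂ).toMatrix_orthonormalBasis_mem_unitary b, ?_⟩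
  rw [← hb _ rfl]
  ext i
  simp [act, zeroState, Matrix.toLpLin_apply, Module.Basis.toMatrix_apply]

/-- `T = H - E₀` is symmetric and kills `z • ψ₀`, so both arguments of `⟨φ, T φ⟩` may be replaced by
the deviation `δ`. The constant is `‖T‖ ≤ ‖H‖ + |E₀| ≤ 2 * ‖H‖`. -/
theorem IsGroundState.abs_energy_sub_le {H : Matrix (Bits n) (Bits n) ℂ} (hH : H.IsHermitian)
    {E₀ : ℝ} {ψ₀ φ : Qubits n} (h : IsGroundState H E₀ ψ₀) (hφ : ‖φ‖ = 1) (z : ℂ) :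
    |energy H φ - E₀| ≤ 2 * ‖H‖ * ‖φ - z • ψ₀‖ ^ 2 := by
  obtain ⟨-, hψ, heig⟩ := h
  have hE : |E₀| ≤ ‖H‖ := by
    have := norm_act_le H ψ₀
    rwa [heig, norm_smul, hψ, mul_one, mul_one, Complex.norm_real, Real.norm_eq_abs] at this
  set T : Qubits n →ₗ[ℂ] Qubits n := Matrix.toEuclideanLin H - (E₀ : ℂ) • LinearMap.id with hTdef
  have hT : T.IsSymmetric := by
    refine LinearMap.IsSymmetric.sub (Matrix.isSymmetric_toEuclideanLin_iff.2 hH) ?_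
    intro x y
    rw [LinearMap.smul_apply, LinearMap.smul_apply, inner_smul_left, inner_smul_right,
      Complex.conj_ofReal]
    rfl
  set δ := φ - z • ψ₀ with hδ
  have hker : T (z • ψ₀) = 0 := by
    have : Matrix.toEuclideanLin H ψ₀ = (E₀ : ℂ) • ψ₀ := heig
    rw [map_smul, hTdef, LinearMap.sub_apply, this]
    simp
  have hTδ : T φ = T δ := by rw [hδ, map_sub, hker, sub_zero]
  have hen : energy H φ - E₀ = (inner ℂ (T δ) δ).re := by
    have h1 : inner ℂ (T δ) δ = inner ℂ φ (T φ) := by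
      rw [← hTδ, hT, ← hTδ]
    have h2 : inner ℂ φ (T φ) = inner ℂ φ (act H φ) - E₀ := by
      have : T φ = act H φ - (E₀ : ℂ) • φ := rfl
      rw [this, inner_sub_right, inner_smul_right, inner_self_eq_norm_sq_to_K, hφ]
      simp
    rw [h1, h2]
    simp [energy]
  have hTn : ‖T δ‖ ≤ 2 * ‖H‖ * ‖δ‖ := by
    have : T δ = act H δ - (E₀ : ℂ) • δ := rfl
    rw [this]
    refine (norm_sub_le _ _).trans ?_
    rw [norm_smul, Complex.norm_real, Real.norm_eq_abs]
    nlinarith [norm_act_le H δ, norm_nonneg δ]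
  rw [hen]
  calc |(inner ℂ (T δ) δ).re| ≤ ‖inner ℂ (T δ) δ‖ := Complex.abs_re_le_norm _
    _ ≤ ‖T δ‖ * ‖δ‖ := norm_inner_le_norm _ _
    _ ≤ 2 * ‖H‖ * ‖δ‖ * ‖δ‖ := by gcongr
    _ = _ := by ring

end VQE

theorem lemma1 :
    ∃ c : ℝ, c ≤ 4 ∧
      ∀ (n : ℕ) (G : Set (VQE.Gate n)), VQE.Universal G → VQE.ClosedUnderInversion G →
        ∃ C : ℝ, ∀ H : Matrix (VQE.Bits n) (VQE.Bits n) ℂ, H.IsHermitian →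
          ∃ K : ℝ, ∀ (E₀ : ℝ) (ψ₀ : VQE.Qubits n), VQE.IsGroundState H E₀ ψ₀ →
            ∀ ε : ℝ, 0 < ε →
              ∃ w : List (VQE.Gate n), (∀ g ∈ w, g ∈ G) ∧
                (ε ≤ 1 / 2 → (w.length : ℝ) ≤ C * Real.log (1 / ε) ^ c) ∧
                (∃ θ : ℝ, ‖VQE.act (VQE.circuitOp w).1 (VQE.zeroState n) -
                    Complex.exp (θ * Complex.I) • ψ₀‖ ≤ ε) ∧
                |VQE.energy H (VQE.act (VQE.circuitOp w).1 (VQE.zeroState n)) - E₀| ≤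
                  K * ε ^ 2 := by
  refine ⟨4, le_rfl, fun n G hG hG' => ?_⟩
  obtain ⟨C, hC⟩ := hG.exists_hasApprox_log_pow hG'
  refine ⟨C, fun H hH => ⟨2 * ‖H‖, fun E₀ ψ₀ hψ₀ ε hε => ?_⟩⟩
  obtain ⟨l, hl, hlen⟩ := hC ε hε
  obtain ⟨U, hU, hUψ⟩ := VQE.exists_act_zeroState_eq hψ₀.2.1
  obtain ⟨w, hw, hwl, θ, hθ⟩ := hl U hU
  have hstate : ‖VQE.act (VQE.circuitOp w).1 (VQE.zeroState n) -
      Complex.exp ((-θ : ℝ) * Complex.I) • ψ₀‖ ≤ ε := by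
    have h1 : VQE.act (VQE.circuitOp w).1 (VQE.zeroState n) -
        Complex.exp ((-θ : ℝ) * Complex.I) • ψ₀ =
        VQE.act ((VQE.circuitOp w).1 - Complex.exp ((-θ : ℝ) * Complex.I) • U)
          (VQE.zeroState n) := by
      rw [← hUψ]
      simp only [VQE.act, map_sub, map_smul, LinearMap.sub_apply, LinearMap.smul_apply]
    rw [h1]
    refine (VQE.norm_act_le _ _).trans ?_
    rw [VQE.norm_zeroState, mul_one, VQE.norm_exp_smul_sub, neg_neg]
    exact hθ
  refine ⟨w, hw, fun h => ?_, ⟨-θ, hstate⟩, ?_⟩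
  · have : Real.log (1 / ε) ^ (4 : ℝ) = Real.log (1 / ε) ^ 4 := by
      exact_mod_cast Real.rpow_natCast (Real.log (1 / ε)) 4
    rw [this]
    exact (Nat.cast_le.2 hwl).trans (hlen h)
  · refine (hψ₀.abs_energy_sub_le hH ((VQE.norm_act_unitary _ _).trans VQE.norm_zeroState)
      (Complex.exp ((-θ : ℝ) * Complex.I))).trans ?_
    gcongr
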